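/- Fix two numbers $\delta_0,\rho_0\in(0,1)$ and put $$\alpha_0=\frac{(1-\rho_0)(1-\delta_0)^2}{\rho_0},\qquad \beta_0=\frac{(1-\rho_0)(1-\delta_0)}{\rho_0}.$$ A standardized Gaussian vector is a jointly Gaussian random vector $X=(X_1,\dots,X_n)$ (possibly with singular covariance) with $\mathbb E[X_i]=0$ and $\operatorname{var}(X_i)=1$ for all $i$; $R=(R_{ij})$ denotes its correlation matrix, and $\|X\|_\infty=\max_{1\le i\le n}|X_i|$. Call a constant $C>0$ admissible for $(\delta_0,\rho_0)$ if $$\mathbb P\Big(\max_{1\le i\le n}X_i\le \delta_0\sqrt{2(1-\rho_0)\log n}\Big)\le C\,n^{-\alpha_0}(\log n)^{\frac{\beta_0-1}{2}}$$ for every $n\ge 2$ and every standardized Gaussian vector $X\in\mathbb R^n$ with $\max_{i\ne j}R_{ij}\le\rho_0$. Then an admissible constant $C>0$ (depending only on $(\delta_0,\rho_0)$) exists. Moreover, for every admissible $C$ and every standardized Gaussian vector $X\in\mathbb R^n$ the following hold. (1) If $n\ge 1$ and $|R_{ij}|\le\rho_0$ for all $i\ne j$, then $$\mathbb P\Big(\|X\|_\infty\le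 \delta_0\sqrt{2(1-\rho_0)\log(2n)}\Big)\le C\,(2n)^{-\alpha_0}\,\log(2n)^{\frac{\beta_0-1}{2}}.$$ (2) If $n\ge 2$ and $R_{ij}\in[0,\rho_0]$ for all $i\ne j$, then $$\mathbb P\Big(\|X\|_\infty\le \delta_0\sqrt{2(1-\rho_0)\log n}\Big)\le C^2\,n^{-2\alpha_0}\,(\log n)^{\beta_0-1}.$$ -/

import Mathlib

open MeasureTheory ProbabilityTheory

noncomputable section

/-- `X = (X₁, …, Xₙ)` is a (possibly degenerate) jointly Gaussian random vector on `(Ω, P)` whose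
entries are standardized: mean `0` and variance `1`. -/
structure IsStdGaussianVector {Ω : Type*} [MeasurableSpace Ω] {n : ℕ} (P : Measure Ω)
    (X : Ω → Fin n → ℝ) : Prop where
  hasGaussianLaw : HasGaussianLaw X P
  mean_eq_zero : ∀ i, ∫ ω, X ω i ∂P = 0
  variance_eq_one : ∀ i, Var[fun ω => X ω i; P] = 1

/-- The correlation matrix `R` of a random vector. -/
def corrMatrix {Ω : Type*} [MeasurableSpace Ω] {n : ℕ} (P : Measure Ω)
    (X : Ω → Fin n → ℝ) : Matrix (Fin n) (Fin n) ℝ :=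
  fun i j => cov[fun ω => X ω i, fun ω => X ω j; P] /
    (√(Var[fun ω => X ω i; P]) * √(Var[fun ω => X ω j; P]))

/-- The maximum `M_n(X) = max_{1 ≤ i ≤ n} X_i` of a vector (used only for `n ≥ 2`, where it is
the maximum of a nonempty finite family). -/
def vecMax {n : ℕ} (x : Fin n → ℝ) : ℝ := ⨆ i, x i

/-- `α₀ = (1 - ρ₀)(1 - δ₀)² / ρ₀`. -/
def alphaZero (δ₀ ρ₀ : ℝ) : ℝ := (1 - ρ₀) * (1 - δ₀) ^ 2 / ρ₀

/-- `β₀ = (1 - ρ₀)(1 - δ₀) / ρ₀`. -/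
def betaZero (δ₀ ρ₀ : ℝ) : ℝ := (1 - ρ₀) * (1 - δ₀) / ρ₀

/-- `C` is a constant in the lower-tail bound for the maximum: the bound
`P(max_i X_i ≤ δ₀ √(2(1-ρ₀) log n)) ≤ C n^(-α₀) (log n)^((β₀-1)/2)`
holds for all `n ≥ 2` and all standardized Gaussian vectors with `max_{i ≠ j} R_ij ≤ ρ₀`.
Only the law of `X` matters, so probability spaces in `Type` suffice
(for example `Fin n → ℝ` itself). -/
def IsMaxBoundConstant (δ₀ ρ₀ C : ℝ) : Prop :=
  ∀ n : ℕ, 2 ≤ n → ∀ (Ω : Type) [MeasurableSpace Ω] (P : Measure Ω) (X : Ω → Fin n → ℝ),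
    IsStdGaussianVector P X →
    (∀ i j, i ≠ j → corrMatrix P X i j ≤ ρ₀) →
    P.real {ω | vecMax (X ω) ≤ δ₀ * √(2 * (1 - ρ₀) * Real.log n)} ≤
      C * (n : ℝ) ^ (-alphaZero δ₀ ρ₀) * Real.log n ^ ((betaZero δ₀ ρ₀ - 1) / 2)

end

/-!
Slepian's inequality is obtained by Lindeberg replacement. A centred Gaussian measure is the
`m`-fold convolution of its rescaling by `1 / √m`. Exchanging the factors of two such measures one
at a time compares the integrals of a smooth function `F` up to `O(1 / √m)`, as soon as the
integrals of the second derivatives of `F` are ordered. For a product of smooth nonincreasing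
cutoffs the mixed second derivatives are nonnegative, so the order of the covariances is inherited.

Comparison with `√(1 - ρ) ξᵢ - √ρ W`, where `W` and the `ξᵢ` are independent standard normal
variables, bounds the lower tail of the maximum by `∫ Φ (δ s + c w) ^ n dγ(w)`, where
`s = √(2 log n)` and `c = √ρ / √(1 - ρ)`. The power `Φ t ^ n` is negligible as long as `t` stays
below the level `s - log s / s`, so the integral is of the order of the Gaussian tail at
`((1 - δ) s - log s / s) / c`; the term `log s / s` is what produces the logarithmic factor
`(log n) ^ (β / 2)`, and Mills' ratio produces `(log n) ^ (-1 / 2)`.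

The first bound for the sup norm is the lower-tail bound for the `2 * n` coordinates of `(X, -X)`.
For the second, `X` and `-X` have nonpositive cross covariances, so by Slepian's inequality the
events `max X ≤ u` and `max (-X) ≤ u` are negatively dependent, and the lower-tail bound is squared.
-/

open Filter Asymptotics
open scoped Topology

noncomputable section

section Taylor

variable {E G : Type*} [NormedAddCommGroup E] [NormedSpace ℝ E] [NormedAddCommGroup G]
  [NormedSpace ℝ G] [CompleteSpace G]

open Nat in
lemma norm_sub_sum_iteratedFDeriv_le {f : E → G} {n : ℕ} {B : ℝ} (hf : ContDiff ℝ (n + 1) f)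
    (hB : ∀ x, ‖iteratedFDeriv ℝ (n + 1) f x‖ ≤ B) (x y : E) :
    ‖f (x + y) - ∑ k ∈ Finset.range (n + 1), (k ! : ℝ)⁻¹ • iteratedFDeriv ℝ k f x (fun _ ↦ y)‖ ≤
      (n ! : ℝ)⁻¹ * (B * ‖y‖ ^ (n + 1)) := by
  rw [map_add_eq_sum_add_integral_iteratedFDeriv fun t _ ↦ hf.contDiffAt, add_sub_cancel_left,
    norm_smul, norm_inv, RCLike.norm_natCast]
  gcongr
  refine (intervalIntegral.norm_integral_le_of_norm_le_const (C := B * ‖y‖ ^ (n + 1))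
    fun t ht ↦ ?_).trans (by simp)
  rw [Set.uIoc_of_le zero_le_one] at ht
  have ht' : ‖(1 - t) ^ n‖ ≤ 1 := by
    rw [norm_pow, Real.norm_of_nonneg (by linarith [ht.2])]
    exact pow_le_one₀ (by linarith [ht.2]) (by linarith [ht.1])
  calc ‖(1 - t) ^ n • iteratedFDeriv ℝ (n + 1) f (x + t • y) fun _ ↦ y‖
      ≤ 1 * ‖iteratedFDeriv ℝ (n + 1) f (x + t • y) fun _ ↦ y‖ := by
        rw [norm_smul]
        gcongr
    _ ≤ B * ‖y‖ ^ (n + 1) := by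
        rw [one_mul]
        simpa using (iteratedFDeriv ℝ (n + 1) f (x + t • y)).le_of_opNorm_le (hB _) fun _ ↦ y

end Taylor

section SecondOrderExpansion

variable {E : Type*} [NormedAddCommGroup E] [NormedSpace ℝ E] [MeasurableSpace E] [BorelSpace E]
  {F : E → ℝ}

lemma integrable_iteratedFDeriv_two {μ : Measure E} (hμ : MemLp id 2 μ) (b : E) :
    Integrable (fun x ↦ iteratedFDeriv ℝ 2 F b fun _ ↦ x) μ := by
  refine ((hμ.integrable_norm_pow two_ne_zero).const_mul ‖iteratedFDeriv ℝ 2 F b‖).mono'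
    (by fun_prop : Continuous _).aestronglyMeasurable (ae_of_all _ fun x ↦ ?_)
  simpa using (iteratedFDeriv ℝ 2 F b).le_opNorm fun _ ↦ x

variable [CompleteSpace E] {A B : ℝ}

lemma abs_integral_sub_sub_integral_iteratedFDeriv_two_le {μ : Measure E} [IsProbabilityMeasure μ]
    (hμ : MemLp id 3 μ) (hμ0 : ∫ x, x ∂μ = 0) (hF : ContDiff ℝ 3 F) (hA : ∀ x, |F x| ≤ A)
    (hB : ∀ x, ‖iteratedFDeriv ℝ 3 F x‖ ≤ B) (b : E) :
    |∫ x, F (b + x) ∂μ - F b - (∫ x, iteratedFDeriv ℝ 2 F b (fun _ ↦ x) ∂μ) / 2| ≤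
      B / 2 * ∫ x, ‖x‖ ^ 3 ∂μ := by
  have hid : Integrable (fun x ↦ x) μ := hμ.integrable (by norm_num)
  have hF' : Integrable (fun x ↦ F (b + x)) μ :=
    .of_bound (hF.continuous.comp (by fun_prop)).aestronglyMeasurable A (ae_of_all _ fun x ↦ hA _)
  have hF₀ : Integrable (fun x ↦ F (b + x) - F b) μ := hF'.sub (integrable_const _)
  have hD₁ : Integrable (fun x ↦ fderiv ℝ F b x) μ := (fderiv ℝ F b).integrable_comp hid
  have hF₁ : Integrable (fun x ↦ F (b + x) - F b - fderiv ℝ F b x) μ := hF₀.sub hD₁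
  have hD₂ := integrable_iteratedFDeriv_two (F := F) (hμ.mono_exponent (by norm_num)) b
  have hmean : ∫ x, fderiv ℝ F b x ∂μ = 0 := by
    rw [ContinuousLinearMap.integral_comp_comm _ hid, hμ0, map_zero]
  have hexpand : ∫ x, (F (b + x) - F b - fderiv ℝ F b x -
      (iteratedFDeriv ℝ 2 F b fun _ ↦ x) / 2) ∂μ =
      ∫ x, F (b + x) ∂μ - F b - (∫ x, iteratedFDeriv ℝ 2 F b (fun _ ↦ x) ∂μ) / 2 := by
    rw [integral_sub hF₁ (hD₂.div_const 2), integral_sub hF₀ hD₁,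
      integral_sub hF' (integrable_const _), hmean, integral_div]
    simp
  rw [← hexpand, ← integral_const_mul]
  refine abs_integral_le_integral_abs.trans (integral_mono_of_nonneg
    (ae_of_all _ fun x ↦ abs_nonneg _)
    ((hμ.integrable_norm_pow three_ne_zero).const_mul (B / 2)) (ae_of_all _ fun x ↦ ?_))
  have := norm_sub_sum_iteratedFDeriv_le (n := 2) hF hB b x
  norm_num [Finset.sum_range_succ, ← sub_sub, div_eq_inv_mul, mul_assoc] at this ⊢
  exact this

end SecondOrderExpansion

section ConvolutionPowers

variable {E : Type*} [AddCommMonoid E] [MeasurableSpace E] [MeasurableAdd₂ E]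

/-- The `k`-fold convolution power of a measure: the law of a sum of `k` independent variables
with law `μ`. -/
def convPow (μ : Measure E) : ℕ → Measure E
  | 0 => Measure.dirac 0
  | k + 1 => (convPow μ k).conv μ

instance isProbabilityMeasure_convPow (μ : Measure E) [IsProbabilityMeasure μ] (k : ℕ) :
    IsProbabilityMeasure (convPow μ k) := by
  induction k with
  | zero => exact Measure.dirac.isProbabilityMeasure
  | succ k ih => exact inferInstanceAs (IsProbabilityMeasure ((convPow μ k).conv μ))

variable {F : E → ℝ} {K e : ℝ} {μ ν : Measure E} [IsProbabilityMeasure μ] [IsProbabilityMeasure ν]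

lemma integral_conv_le (hF : Measurable F) (hK : ∀ x, |F x| ≤ K)
    (hstep : ∀ b, ∫ x, F (b + x) ∂μ ≤ ∫ x, F (b + x) ∂ν + e) (β : Measure E)
    [IsProbabilityMeasure β] :
    ∫ x, F x ∂(β.conv μ) ≤ ∫ x, F x ∂(β.conv ν) + e := by
  have hint (κ : Measure E) [IsProbabilityMeasure κ] : Integrable F κ :=
    .of_bound hF.aestronglyMeasurable K (ae_of_all _ hK)
  have hint_inner (κ : Measure E) [IsProbabilityMeasure κ] :
      Integrable (fun b ↦ ∫ x, F (b + x) ∂κ) β :=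
    ((integrable_map_measure hF.aestronglyMeasurable measurable_add.aemeasurable).1
      (hint (β.conv κ))).integral_prod_left
  rw [integral_conv (hint _), integral_conv (hint _)]
  calc ∫ b, ∫ x, F (b + x) ∂μ ∂β ≤ ∫ b, (∫ x, F (b + x) ∂ν + e) ∂β :=
        integral_mono (hint_inner μ) ((hint_inner ν).add (integrable_const e)) hstep
    _ = ∫ b, ∫ x, F (b + x) ∂ν ∂β + e := by
        rw [integral_add (hint_inner ν) (integrable_const e)]
        simp

lemma integral_conv_convPow_le (hF : Measurable F) (hK : ∀ x, |F x| ≤ K)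
    (hstep : ∀ b, ∫ x, F (b + x) ∂μ ≤ ∫ x, F (b + x) ∂ν + e) (k : ℕ) (β : Measure E)
    [IsProbabilityMeasure β] :
    ∫ x, F x ∂(β.conv (convPow μ k)) ≤ ∫ x, F x ∂(β.conv (convPow ν k)) + k * e := by
  induction k generalizing β with
  | zero => simp [convPow]
  | succ k ih =>
    have hlast : ∫ x, F x ∂(β.conv (convPow μ (k + 1))) ≤
        ∫ x, F x ∂((β.conv ν).conv (convPow μ k)) + e := by
      rw [convPow, Measure.conv_assoc β, Measure.conv_comm ν, ← Measure.conv_assoc,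
        ← Measure.conv_assoc]
      exact integral_conv_le hF hK hstep _
    have hinit := ih (β.conv ν)
    rw [Measure.conv_assoc β ν (convPow ν k), Measure.conv_comm ν, ← convPow] at hinit
    push_cast
    linarith

lemma integral_convPow_le (hF : Measurable F) (hK : ∀ x, |F x| ≤ K)
    (hstep : ∀ b, ∫ x, F (b + x) ∂μ ≤ ∫ x, F (b + x) ∂ν + e) (k : ℕ) :
    ∫ x, F x ∂(convPow μ k) ≤ ∫ x, F x ∂(convPow ν k) + k * e := by
  simpa using integral_conv_convPow_le hF hK hstep k (Measure.dirac 0)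

end ConvolutionPowers

section GaussianComparison

variable {E : Type*} [NormedAddCommGroup E] [NormedSpace ℝ E] [MeasurableSpace E] [BorelSpace E]
  [SecondCountableTopology E]

lemma charFunDual_convPow (μ : Measure E) [IsProbabilityMeasure μ] (k : ℕ) (L : StrongDual ℝ E) :
    charFunDual (convPow μ k) L = charFunDual μ L ^ k := by
  induction k with
  | zero => simp [convPow]
  | succ k ih => rw [convPow, charFunDual_conv, ih, pow_succ]

variable [CompleteSpace E]

lemma convPow_map_inv_sqrt_smul (μ : Measure E) [IsGaussian μ] (hμ : ∫ x, x ∂μ = 0) {m : ℕ}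
    (hm : m ≠ 0) : convPow (μ.map ((√m)⁻¹ • ContinuousLinearMap.id ℝ E)) m = μ := by
  refine Measure.ext_of_charFunDual (funext fun L ↦ ?_)
  have hL : L ∘L ((√m)⁻¹ • ContinuousLinearMap.id ℝ E) = (√m)⁻¹ • L := by
    ext x
    simp
  have hvar : Var[⇑((√m)⁻¹ • L); μ] = (m : ℝ)⁻¹ * Var[L; μ] := by
    rw [FunLike.coe_smul, variance_smul, inv_pow, Real.sq_sqrt (by positivity)]
  have hm' : (m : ℂ) ≠ 0 := by exact_mod_cast hm
  rw [charFunDual_convPow, charFunDual_map, hL,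
    IsGaussian.charFunDual_eq_of_integral_eq_zero hμ,
    IsGaussian.charFunDual_eq_of_integral_eq_zero hμ, ← Complex.exp_nat_mul, hvar]
  congr 1
  push_cast
  field_simp

lemma abs_integral_map_smul_sub_le {μ : Measure E} [IsProbabilityMeasure μ] (hμ3 : MemLp id 3 μ)
    (hμ : ∫ x, x ∂μ = 0) {F : E → ℝ} {A B : ℝ} (hF : ContDiff ℝ 3 F) (hA : ∀ x, |F x| ≤ A)
    (hB : ∀ x, ‖iteratedFDeriv ℝ 3 F x‖ ≤ B) {r : ℝ} (hr : 0 ≤ r) (b : E) :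
    |∫ x, F (b + x) ∂(μ.map (r • ContinuousLinearMap.id ℝ E)) - F b -
        r ^ 2 * (∫ x, iteratedFDeriv ℝ 2 F b (fun _ ↦ x) ∂μ) / 2| ≤
      r ^ 3 * (B / 2 * ∫ x, ‖x‖ ^ 3 ∂μ) := by
  set L := r • ContinuousLinearMap.id ℝ E
  have hmap {g : E → ℝ} (hg : Continuous g) : ∫ x, g x ∂(μ.map L) = ∫ x, g (r • x) ∂μ :=
    integral_map L.continuous.aemeasurable hg.aestronglyMeasurable
  have := Measure.isProbabilityMeasure_map L.continuous.aemeasurable (μ := μ)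
  have hmem : MemLp id 3 (μ.map L) :=
    (memLp_map_measure_iff aestronglyMeasurable_id L.continuous.aemeasurable).2
      (L.comp_memLp' hμ3)
  have hmean : ∫ x, x ∂(μ.map L) = 0 := by
    rw [integral_map (φ := L) (f := fun x ↦ x) L.continuous.aemeasurable aestronglyMeasurable_id]
    exact (integral_smul r fun x ↦ x).trans (by rw [hμ, smul_zero])
  have hquad : ∫ x, iteratedFDeriv ℝ 2 F b (fun _ ↦ x) ∂(μ.map L) =
      r ^ 2 * ∫ x, iteratedFDeriv ℝ 2 F b (fun _ ↦ x) ∂μ := by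
    rw [hmap (by fun_prop), ← integral_const_mul]
    congr with x
    simpa using (iteratedFDeriv ℝ 2 F b).map_smul_univ (fun _ ↦ r) fun _ ↦ x
  have hcube : ∫ x, ‖x‖ ^ 3 ∂(μ.map L) = r ^ 3 * ∫ x, ‖x‖ ^ 3 ∂μ := by
    rw [hmap (by fun_prop)]
    simp_rw [norm_smul, mul_pow, Real.norm_of_nonneg hr, integral_const_mul]
  have h := abs_integral_sub_sub_integral_iteratedFDeriv_two_le hmem hmean hF hA hB b
  rw [hquad, hcube] at h
  linarith

theorem integral_le_of_integral_iteratedFDeriv_two_le {μ ν : Measure E} [IsGaussian μ]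
    [IsGaussian ν] (hμ : ∫ x, x ∂μ = 0) (hν : ∫ x, x ∂ν = 0) {F : E → ℝ} {A B : ℝ}
    (hF : ContDiff ℝ 3 F) (hA : ∀ x, |F x| ≤ A) (hB : ∀ x, ‖iteratedFDeriv ℝ 3 F x‖ ≤ B)
    (hle : ∀ b, ∫ x, iteratedFDeriv ℝ 2 F b (fun _ ↦ x) ∂μ ≤
      ∫ x, iteratedFDeriv ℝ 2 F b (fun _ ↦ x) ∂ν) :
    ∫ x, F x ∂μ ≤ ∫ x, F x ∂ν := by
  set K : ℝ := B / 2 * ∫ x, ‖x‖ ^ 3 ∂μ + B / 2 * ∫ x, ‖x‖ ^ 3 ∂ν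
  have hstep {r : ℝ} (hr : 0 ≤ r) (b : E) :
      ∫ x, F (b + x) ∂(μ.map (r • ContinuousLinearMap.id ℝ E)) ≤
        ∫ x, F (b + x) ∂(ν.map (r • ContinuousLinearMap.id ℝ E)) + r ^ 3 * K := by
    have hμr := (abs_le.1 <| abs_integral_map_smul_sub_le
      (IsGaussian.memLp_id μ 3 (by norm_num)) hμ hF hA hB hr b).2
    have hνr := (abs_le.1 <| abs_integral_map_smul_sub_le
      (IsGaussian.memLp_id ν 3 (by norm_num)) hν hF hA hB hr b).1
    have := mul_le_mul_of_nonneg_left (hle b) (sq_nonneg r)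
    simp only [K, mul_add]
    linarith
  have hbound : ∀ m : ℕ, m ≠ 0 → ∫ x, F x ∂μ ≤ ∫ x, F x ∂ν + (√m)⁻¹ * K := by
    intro m hm
    have h := integral_convPow_le hF.continuous.measurable hA
      (hstep (r := (√m)⁻¹) (by positivity)) m
    have hscale : (m : ℝ) * ((√m)⁻¹ ^ 3 * K) = (√m)⁻¹ * K := by
      have : (m : ℝ) * (√m)⁻¹ ^ 2 = 1 := by
        rw [inv_pow, Real.sq_sqrt m.cast_nonneg, mul_inv_cancel₀ (by exact_mod_cast hm)]
      linear_combination (√m)⁻¹ * K * this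
    rwa [convPow_map_inv_sqrt_smul μ hμ hm, convPow_map_inv_sqrt_smul ν hν hm, hscale] at h
  have hlim : Tendsto (fun m : ℕ ↦ ∫ x, F x ∂ν + (√m)⁻¹ * K) atTop (𝓝 (∫ x, F x ∂ν)) := by
    simpa using ((Real.tendsto_sqrt_atTop.comp
      tendsto_natCast_atTop_atTop).inv_tendsto_atTop.mul_const K).const_add (∫ x, F x ∂ν)
  exact ge_of_tendsto hlim ((eventually_ne_atTop 0).mono hbound)

end GaussianComparison

section BoundedDerivatives

open scoped ContDiff

variable {E G : Type*} [NormedAddCommGroup E] [NormedSpace ℝ E] [NormedAddCommGroup G]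
  [NormedSpace ℝ G]

/-- The test functions of the smoothing argument: smooth functions all of whose derivatives,
including the function itself, are bounded. -/
structure IsSmoothBounded (f : E → ℝ) : Prop where
  contDiff : ContDiff ℝ ∞ f
  exists_norm_iteratedFDeriv_le : ∀ k : ℕ, ∃ C, ∀ x, ‖iteratedFDeriv ℝ k f x‖ ≤ C

lemma IsSmoothBounded.comp_continuousLinearMap {f : E → ℝ} (hf : IsSmoothBounded f)
    (L : G →L[ℝ] E) : IsSmoothBounded fun x ↦ f (L x) where
  contDiff := hf.contDiff.comp L.contDiff
  exists_norm_iteratedFDeriv_le k := by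
    obtain ⟨C, hC⟩ := hf.exists_norm_iteratedFDeriv_le k
    refine ⟨C * ∏ _i : Fin k, ‖L‖, fun x ↦ ?_⟩
    have hcomp : iteratedFDeriv ℝ k (f ∘ L) x = _ :=
      L.iteratedFDeriv_comp_right hf.contDiff x (by exact_mod_cast le_top)
    change ‖iteratedFDeriv ℝ k (f ∘ L) x‖ ≤ _
    rw [hcomp]
    refine (ContinuousMultilinearMap.norm_compContinuousLinearMap_le _ _).trans ?_
    gcongr
    exact hC _

lemma IsSmoothBounded.prod {κ : Type*} {s : Finset κ} {f : κ → E → ℝ}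
    (hf : ∀ i, IsSmoothBounded (f i)) : IsSmoothBounded fun x ↦ ∏ i ∈ s, f i x where
  contDiff := contDiff_prod fun i _ ↦ (hf i).contDiff
  exists_norm_iteratedFDeriv_le k := by
    classical
    choose C hC using fun i ↦ (hf i).exists_norm_iteratedFDeriv_le
    refine ⟨_, fun x ↦ (norm_iteratedFDeriv_prod_le (u := s) (N := ∞)
      (fun i _ ↦ (hf i).contDiff) (x := x) (by exact_mod_cast le_top)).trans <|
      Finset.sum_le_sum fun p _ ↦ mul_le_mul_of_nonneg_left
        (Finset.prod_le_prod (fun _ _ ↦ norm_nonneg _) fun i _ ↦ hC i _ x) (Nat.cast_nonneg _)⟩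

lemma isSmoothBounded_of_hasCompactSupport_deriv {f : ℝ → ℝ} {C : ℝ} (hf : ContDiff ℝ ∞ f)
    (hC : ∀ x, |f x| ≤ C) (hf' : HasCompactSupport (deriv f)) : IsSmoothBounded f where
  contDiff := hf
  exists_norm_iteratedFDeriv_le k := by
    cases k with
    | zero => exact ⟨C, by simpa using hC⟩
    | succ k =>
      have hderiv : ContDiff ℝ ∞ (deriv f) := (contDiff_infty_iff_deriv.1 hf).2
      simp_rw [norm_iteratedFDeriv_eq_norm_iteratedDeriv, iteratedDeriv_succ',
        ← norm_iteratedFDeriv_eq_norm_iteratedDeriv]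
      exact (hf'.iteratedFDeriv k).exists_bound_of_continuous
        (hderiv.continuous_iteratedFDeriv (by exact_mod_cast le_top))

end BoundedDerivatives

section SmoothCutoff

open scoped ContDiff

/-- A smooth nonincreasing function equal to `1` on `(-∞, u]` and to `0` on `[u + 1 / k, ∞)`,
for `k > 0`. -/
def smoothCutoff (u k x : ℝ) : ℝ := 1 - Real.smoothTransition (k * (x - u))

variable {u k x : ℝ}

lemma contDiff_smoothCutoff : ContDiff ℝ ∞ (smoothCutoff u k) :=
  contDiff_const.sub (Real.smoothTransition.contDiff.comp (by fun_prop))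

lemma smoothCutoff_nonneg : 0 ≤ smoothCutoff u k x :=
  sub_nonneg.2 (Real.smoothTransition.le_one _)

lemma smoothCutoff_le_one : smoothCutoff u k x ≤ 1 :=
  sub_le_self _ (Real.smoothTransition.nonneg _)

lemma antitone_smoothCutoff (hk : 0 ≤ k) : Antitone (smoothCutoff u k) := fun _ _ h ↦
  sub_le_sub_left (Real.smoothTransition.monotone (by gcongr)) 1

lemma smoothCutoff_of_le (hk : 0 ≤ k) (hx : x ≤ u) : smoothCutoff u k x = 1 := by
  rw [smoothCutoff, Real.smoothTransition.zero_of_nonpos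
    (mul_nonpos_of_nonneg_of_nonpos hk (sub_nonpos.2 hx)), sub_zero]

lemma smoothCutoff_of_one_le (hx : 1 ≤ k * (x - u)) : smoothCutoff u k x = 0 := by
  rw [smoothCutoff, Real.smoothTransition.one_of_one_le hx, sub_self]

lemma hasCompactSupport_deriv_smoothCutoff (hk : 0 < k) :
    HasCompactSupport (deriv (smoothCutoff u k)) := by
  refine .intro (isCompact_Icc (a := u) (b := u + 1 / k)) fun x hx ↦ ?_
  rcases le_or_gt x u with hxu | hxu
  · refine IsLocalMax.deriv_eq_zero (Eventually.of_forall fun y ↦ ?_)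
    rw [smoothCutoff_of_le hk.le hxu]
    exact smoothCutoff_le_one
  · have hx' : 1 ≤ k * (x - u) := by
      rw [← div_le_iff₀' hk]
      by_contra! h
      exact hx ⟨hxu.le, by linarith⟩
    refine IsLocalMin.deriv_eq_zero (Eventually.of_forall fun y ↦ ?_)
    rw [smoothCutoff_of_one_le hx']
    exact smoothCutoff_nonneg

lemma isSmoothBounded_smoothCutoff (hk : 0 < k) : IsSmoothBounded (smoothCutoff u k) :=
  isSmoothBounded_of_hasCompactSupport_deriv contDiff_smoothCutoff
    (fun _ ↦ (abs_of_nonneg smoothCutoff_nonneg).trans_le smoothCutoff_le_one)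
    (hasCompactSupport_deriv_smoothCutoff hk)

lemma tendsto_smoothCutoff (u x : ℝ) :
    Tendsto (fun k : ℕ ↦ smoothCutoff u k x) atTop (𝓝 ((Set.Iic u).indicator 1 x)) := by
  rcases le_or_gt x u with hx | hx
  · simp [smoothCutoff_of_le (Nat.cast_nonneg _) hx, hx]
  · rw [Set.indicator_of_notMem (by simpa using hx)]
    refine tendsto_const_nhds.congr' ?_
    filter_upwards [(tendsto_natCast_atTop_atTop.atTop_mul_const
      (sub_pos.2 hx)).eventually_ge_atTop (1 : ℝ)] with k hk
    exact (smoothCutoff_of_one_le hk).symm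

end SmoothCutoff

section Slepian

variable {ι : Type*} [Fintype ι]

lemma integral_iteratedFDeriv_two_eq_sum_covariance [DecidableEq ι] {μ : Measure (ι → ℝ)}
    [IsProbabilityMeasure μ] (hμ2 : MemLp id 2 μ) (hμ : ∀ i, ∫ x, x i ∂μ = 0) (F : (ι → ℝ) → ℝ)
    (b : ι → ℝ) :
    ∫ x, iteratedFDeriv ℝ 2 F b (fun _ ↦ x) ∂μ = ∑ i, ∑ j, cov[fun x ↦ x i, fun x ↦ x j; μ] *
      iteratedFDeriv ℝ 2 F b ![Pi.single i 1, Pi.single j 1] := by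
  have hmem (i : ι) : MemLp (fun x : ι → ℝ ↦ x i) 2 μ :=
    (ContinuousLinearMap.proj (R := ℝ) (φ := fun _ : ι ↦ ℝ) i).comp_memLp' hμ2
  have hcov (i j : ι) : cov[fun x ↦ x i, fun x ↦ x j; μ] = ∫ x, x i * x j ∂μ := by
    simp [covariance_eq_sub (hmem i) (hmem j), hμ]
  have hint (i j : ι) : Integrable (fun x : ι → ℝ ↦
      x i * x j * iteratedFDeriv ℝ 2 F b ![Pi.single i 1, Pi.single j 1]) μ :=
    ((hmem i).integrable_mul (hmem j)).mul_const _
  have hbilin (x : ι → ℝ) : iteratedFDeriv ℝ 2 F b (fun _ ↦ x) = ∑ i, ∑ j,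
      x i * x j * iteratedFDeriv ℝ 2 F b ![Pi.single i 1, Pi.single j 1] := by
    simp only [iteratedFDeriv_two_apply, Matrix.cons_val_zero, Matrix.cons_val_one]
    conv_lhs => rw [pi_eq_sum_univ' x]
    rw [Finset.sum_comm]
    simp [Finset.mul_sum, mul_assoc, mul_left_comm]
  simp_rw [hbilin]
  rw [integral_finsetSum _ fun i _ ↦ integrable_finsetSum _ fun j _ ↦ hint i j]
  simp_rw [integral_finsetSum _ fun j _ ↦ hint _ j, integral_mul_const, hcov]

lemma integral_eq_zero_of_forall_integral_eval_eq_zero {μ : Measure (ι → ℝ)}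
    (hint : Integrable id μ) (hμ : ∀ i, ∫ x, x i ∂μ = 0) : ∫ x, x ∂μ = 0 := by
  ext i
  simpa [hμ] using
    ((ContinuousLinearMap.proj (R := ℝ) (φ := fun _ : ι ↦ ℝ) i).integral_comp_comm hint).symm

lemma integral_le_of_covariance_le [DecidableEq ι] {μ ν : Measure (ι → ℝ)} [IsGaussian μ]
    [IsGaussian ν] (hμ : ∀ i, ∫ x, x i ∂μ = 0) (hν : ∀ i, ∫ x, x i ∂ν = 0)
    (hvar : ∀ i, Var[fun x ↦ x i; μ] = Var[fun x ↦ x i; ν])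
    (hcov : ∀ i j, i ≠ j →
      cov[fun x ↦ x i, fun x ↦ x j; μ] ≤ cov[fun x ↦ x i, fun x ↦ x j; ν])
    {F : (ι → ℝ) → ℝ} (hF : IsSmoothBounded F)
    (hmixed : ∀ b i j, i ≠ j → 0 ≤ iteratedFDeriv ℝ 2 F b ![Pi.single i 1, Pi.single j 1]) :
    ∫ x, F x ∂μ ≤ ∫ x, F x ∂ν := by
  obtain ⟨A, hA⟩ := hF.exists_norm_iteratedFDeriv_le 0
  obtain ⟨B, hB⟩ := hF.exists_norm_iteratedFDeriv_le 3
  refine integral_le_of_integral_iteratedFDeriv_two_le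
    (integral_eq_zero_of_forall_integral_eval_eq_zero IsGaussian.integrable_id hμ)
    (integral_eq_zero_of_forall_integral_eval_eq_zero IsGaussian.integrable_id hν)
    (hF.contDiff.of_le (WithTop.coe_le_coe.2 le_top)) (by simpa using hA) hB fun b ↦ ?_
  rw [integral_iteratedFDeriv_two_eq_sum_covariance (IsGaussian.memLp_id μ 2 (by norm_num)) hμ,
    integral_iteratedFDeriv_two_eq_sum_covariance (IsGaussian.memLp_id ν 2 (by norm_num)) hν]
  refine Finset.sum_le_sum fun i _ ↦ Finset.sum_le_sum fun j _ ↦ ?_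
  obtain rfl | hij := eq_or_ne i j
  · have hmeas (κ : Measure (ι → ℝ)) : AEMeasurable (fun x : ι → ℝ ↦ x i) κ :=
      (measurable_pi_apply i).aemeasurable
    rw [covariance_self (hmeas μ), covariance_self (hmeas ν), hvar]
  · exact mul_le_mul_of_nonneg_right (hcov i j hij) (hmixed b i j hij)

lemma fderiv_prod_eval_single [DecidableEq ι] {φ : ι → ℝ → ℝ} (hφ : ∀ i, Differentiable ℝ (φ i))
    (y : ι → ℝ) (j : ι) :
    fderiv ℝ (fun x : ι → ℝ ↦ ∏ l, φ l (x l)) y (Pi.single j 1) =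
      deriv (φ j) (y j) * ∏ l ∈ Finset.univ.erase j, φ l (y l) := by
  have hdiff :
      DifferentiableAt ℝ (fun x : ι → ℝ ↦ ∏ l, φ l (x l)) (y + (0 : ℝ) • Pi.single j 1) := by
    fun_prop
  have hline (s : ℝ) : ∏ l, φ l ((y + s • Pi.single j (1 : ℝ) : ι → ℝ) l) =
      φ j (y j + s) * ∏ l ∈ Finset.univ.erase j, φ l (y l) := by
    rw [← Finset.mul_prod_erase _ _ (Finset.mem_univ j)]
    congr 1
    · simp
    · refine Finset.prod_congr rfl fun l hl ↦ ?_
      simp [Finset.ne_of_mem_erase hl]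
  have h := hdiff.deriv_comp_add_smul
  simp_rw [hline] at h
  simpa [deriv_comp_const_add] using h.symm

lemma iteratedFDeriv_two_prod_nonneg [DecidableEq ι] {φ : ι → ℝ → ℝ} (hφ : ∀ i, ContDiff ℝ 2 (φ i))
    (hφ0 : ∀ i x, 0 ≤ φ i x) (hφ' : ∀ i, Antitone (φ i)) (b : ι → ℝ) {i j : ι} (hij : i ≠ j) :
    0 ≤ iteratedFDeriv ℝ 2 (fun x : ι → ℝ ↦ ∏ l, φ l (x l)) b ![Pi.single i 1, Pi.single j 1] := by
  set F : (ι → ℝ) → ℝ := fun x ↦ ∏ l, φ l (x l) with hFdef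
  have hF : ContDiff ℝ 2 F := contDiff_prod fun l _ ↦ (hφ l).comp (contDiff_apply ℝ ℝ l)
  have hdF : Differentiable ℝ (fderiv ℝ F) :=
    (hF.fderiv_right (m := 1) le_rfl).differentiable one_ne_zero
  have hmono : Monotone fun s : ℝ ↦ fderiv ℝ F (b + s • Pi.single i 1) (Pi.single j 1) := by
    intro s t hst
    simp only [hFdef, fderiv_prod_eval_single fun l ↦ (hφ l).differentiable two_ne_zero]
    simp only [Pi.add_apply, Pi.smul_apply, Pi.single_eq_of_ne hij.symm, smul_zero, add_zero]
    refine mul_le_mul_of_nonpos_left (Finset.prod_le_prod (fun l _ ↦ hφ0 l _) fun l _ ↦ ?_)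
      (hφ' j).deriv_nonpos
    have hl : (0 : ℝ) ≤ (Pi.single i 1 : ι → ℝ) l := by simp [Pi.single_apply, apply_ite]
    exact hφ' l (by simpa using mul_le_mul_of_nonneg_right hst hl)
  have hderiv : deriv (fun s : ℝ ↦ fderiv ℝ F (b + s • Pi.single i 1) (Pi.single j 1)) 0 =
      fderiv ℝ (fderiv ℝ F) b (Pi.single i 1) (Pi.single j 1) := by
    have h := (hdF (b + (0 : ℝ) • Pi.single i 1)).clm_apply
      (differentiableAt_const (Pi.single j (1 : ℝ) : ι → ℝ)) |>.deriv_comp_add_smul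
    rw [h, fderiv_clm_apply (hdF _) (by fun_prop)]
    simp
  simpa [iteratedFDeriv_two_apply, ← hderiv] using hmono.deriv_nonneg

end Slepian

section Slepian

variable {ι : Type*} [Finite ι]

lemma measureReal_forall_le_le_of_covariance_le {μ ν : Measure (ι → ℝ)} [IsGaussian μ]
    [IsGaussian ν] (hμ : ∀ i, ∫ x, x i ∂μ = 0) (hν : ∀ i, ∫ x, x i ∂ν = 0)
    (hvar : ∀ i, Var[fun x ↦ x i; μ] = Var[fun x ↦ x i; ν])
    (hcov : ∀ i j, i ≠ j →
      cov[fun x ↦ x i, fun x ↦ x j; μ] ≤ cov[fun x ↦ x i, fun x ↦ x j; ν]) (u : ι → ℝ) :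
    μ.real {x | ∀ i, x i ≤ u i} ≤ ν.real {x | ∀ i, x i ≤ u i} := by
  classical
  cases nonempty_fintype ι
  let F (k : ℕ) (x : ι → ℝ) : ℝ := ∏ i, smoothCutoff (u i) k (x i)
  have hF {k : ℕ} (hk : 0 < k) : IsSmoothBounded (F k) := IsSmoothBounded.prod fun i ↦
    (isSmoothBounded_smoothCutoff (Nat.cast_pos.2 hk)).comp_continuousLinearMap
      (ContinuousLinearMap.proj (R := ℝ) (φ := fun _ : ι ↦ ℝ) i)
  have hcompare {k : ℕ} (hk : 0 < k) : ∫ x, F k x ∂μ ≤ ∫ x, F k x ∂ν :=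
    integral_le_of_covariance_le hμ hν hvar hcov (hF hk) fun b i j hij ↦
      iteratedFDeriv_two_prod_nonneg
        (fun _ ↦ contDiff_smoothCutoff.of_le (WithTop.coe_le_coe.2 le_top))
        (fun _ _ ↦ smoothCutoff_nonneg) (fun _ ↦ antitone_smoothCutoff k.cast_nonneg) b hij
  have hset : MeasurableSet {x : ι → ℝ | ∀ i, x i ≤ u i} := measurableSet_Iic (a := u)
  have hlim (κ : Measure (ι → ℝ)) [IsProbabilityMeasure κ] :
      Tendsto (fun k : ℕ ↦ ∫ x, F k x ∂κ) atTop (𝓝 (κ.real {x | ∀ i, x i ≤ u i})) := by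
    rw [← integral_indicator_one hset]
    refine tendsto_integral_filter_of_dominated_convergence (fun _ ↦ 1) ?_ ?_
      (integrable_const 1) (ae_of_all _ fun x ↦ ?_)
    · filter_upwards [eventually_gt_atTop 0] with k hk
      exact (hF hk).contDiff.continuous.aestronglyMeasurable
    · refine .of_forall fun k ↦ ae_of_all _ fun x ↦ ?_
      rw [Real.norm_of_nonneg (Finset.prod_nonneg fun _ _ ↦ smoothCutoff_nonneg)]
      exact Finset.prod_le_one (fun _ _ ↦ smoothCutoff_nonneg) fun _ _ ↦ smoothCutoff_le_one
    · have hprod : {x : ι → ℝ | ∀ i, x i ≤ u i}.indicator 1 x =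
          ∏ i, (Set.Iic (u i)).indicator (1 : ℝ → ℝ) (x i) := by
        simp [Set.indicator_apply, Finset.prod_ite_zero]
      rw [hprod]
      exact tendsto_finsetProd _ fun i _ ↦ tendsto_smoothCutoff (u i) (x i)
  exact le_of_tendsto_of_tendsto (hlim μ) (hlim ν)
    ((eventually_gt_atTop 0).mono fun k hk ↦ hcompare hk)

variable {Ω Ω' : Type*} [MeasurableSpace Ω] [MeasurableSpace Ω'] {P : Measure Ω} {P' : Measure Ω'}

theorem slepian_inequality {X : Ω → ι → ℝ} {Y : Ω' → ι → ℝ}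
    (hX : HasGaussianLaw X P) (hY : HasGaussianLaw Y P') (hX0 : ∀ i, ∫ ω, X ω i ∂P = 0)
    (hY0 : ∀ i, ∫ ω, Y ω i ∂P' = 0)
    (hvar : ∀ i, Var[fun ω ↦ X ω i; P] = Var[fun ω ↦ Y ω i; P'])
    (hcov : ∀ i j, i ≠ j →
      cov[fun ω ↦ X ω i, fun ω ↦ X ω j; P] ≤ cov[fun ω ↦ Y ω i, fun ω ↦ Y ω j; P'])
    (u : ι → ℝ) :
    P.real {ω | ∀ i, X ω i ≤ u i} ≤ P'.real {ω | ∀ i, Y ω i ≤ u i} := by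
  have := hX.isGaussian_map
  have := hY.isGaussian_map
  have hset : MeasurableSet {x : ι → ℝ | ∀ i, x i ≤ u i} := measurableSet_Iic (a := u)
  have heval (i : ι) : Measurable fun x : ι → ℝ ↦ x i := measurable_pi_apply i
  have h := measureReal_forall_le_le_of_covariance_le (μ := P.map X) (ν := P'.map Y) (u := u)
  simp only [integral_map hX.aemeasurable (heval _).aestronglyMeasurable,
    integral_map hY.aemeasurable (heval _).aestronglyMeasurable,
    variance_map (heval _).aemeasurable hX.aemeasurable,
    variance_map (heval _).aemeasurable hY.aemeasurable,
    covariance_map_fun (heval _).aestronglyMeasurable (heval _).aestronglyMeasurable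
      hX.aemeasurable,
    covariance_map_fun (heval _).aestronglyMeasurable (heval _).aestronglyMeasurable
      hY.aemeasurable,
    map_measureReal_apply_of_aemeasurable hX.aemeasurable hset,
    map_measureReal_apply_of_aemeasurable hY.aemeasurable hset] at h
  exact h hX0 hY0 hvar hcov

end Slepian

section NegativeDependence

variable {ι κ Ω : Type*} [Finite ι] [Finite κ] [MeasurableSpace Ω] {P : Measure Ω}
  {X : Ω → ι → ℝ} {Y : Ω → κ → ℝ}

lemma hasGaussianLaw_sumElim (h : HasGaussianLaw (fun ω ↦ (X ω, Y ω)) P) :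
    HasGaussianLaw (fun ω ↦ Sum.elim (X ω) (Y ω)) P := by
  cases nonempty_fintype ι
  cases nonempty_fintype κ
  have hcoe (p : (ι → ℝ) × (κ → ℝ)) :
      (ContinuousLinearEquiv.sumPiEquivProdPi ℝ ι κ fun _ ↦ ℝ).symm p = Sum.elim p.1 p.2 := by
    ext (a | a) <;> rfl
  simpa only [hcoe] using
    h.map_equiv_fun (ContinuousLinearEquiv.sumPiEquivProdPi ℝ ι κ fun _ ↦ ℝ).symm

lemma hasGaussianLaw_sumElim_prod {Ω' : Type*} [MeasurableSpace Ω'] {P' : Measure Ω'}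
    {Y : Ω' → κ → ℝ} (hX : HasGaussianLaw X P) (hY : HasGaussianLaw Y P') :
    HasGaussianLaw (fun q : Ω × Ω' ↦ Sum.elim (X q.1) (Y q.2)) (P.prod P') := by
  cases nonempty_fintype ι
  cases nonempty_fintype κ
  have := hX.isProbabilityMeasure
  have := hY.isProbabilityMeasure
  have := hX.isGaussian_map
  have := hY.isGaussian_map
  have hfst : HasLaw (fun q : Ω × Ω' ↦ X q.1) (P.map X) (P.prod P') :=
    HasLaw.fun_comp ⟨hX.aemeasurable, rfl⟩ measurePreserving_fst.hasLaw
  have hsnd : HasLaw (fun q : Ω × Ω' ↦ Y q.2) (P'.map Y) (P.prod P') :=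
    HasLaw.fun_comp ⟨hY.aemeasurable, rfl⟩ measurePreserving_snd.hasLaw
  exact hasGaussianLaw_sumElim <| (indepFun_prod₀ hX.aemeasurable hY.aemeasurable).hasGaussianLaw
    hfst.hasGaussianLaw hsnd.hasGaussianLaw

theorem measureReal_forall_le_and_forall_le_le_mul (hXY : HasGaussianLaw (fun ω ↦ (X ω, Y ω)) P)
    (hX0 : ∀ i, ∫ ω, X ω i ∂P = 0) (hY0 : ∀ j, ∫ ω, Y ω j ∂P = 0)
    (hcov : ∀ i j, cov[fun ω ↦ X ω i, fun ω ↦ Y ω j; P] ≤ 0) (u : ι → ℝ) (v : κ → ℝ) :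
    P.real {ω | (∀ i, X ω i ≤ u i) ∧ ∀ j, Y ω j ≤ v j} ≤
      P.real {ω | ∀ i, X ω i ≤ u i} * P.real {ω | ∀ j, Y ω j ≤ v j} := by
  cases nonempty_fintype ι
  cases nonempty_fintype κ
  have := hXY.isProbabilityMeasure
  have hXi (i : ι) : HasGaussianLaw (fun ω ↦ X ω i) P := hXY.fst.eval i
  have hYj (j : κ) : HasGaussianLaw (fun ω ↦ Y ω j) P := hXY.snd.eval j
  have hfst : MeasurePreserving Prod.fst (P.prod P) P := measurePreserving_fst
  have hsnd : MeasurePreserving Prod.snd (P.prod P) P := measurePreserving_snd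
  have hindep (i : ι) (j : κ) : cov[fun q ↦ X q.1 i, fun q ↦ Y q.2 j; P.prod P] = 0 :=
    covariance_fst_snd_prod (hXi i).memLp_two (hYj j).memLp_two
  have hslepian := slepian_inequality (P' := P.prod P)
    (hasGaussianLaw_sumElim hXY) (hasGaussianLaw_sumElim_prod hXY.fst hXY.snd)
    (by simp [hX0, hY0])
    (by
      rintro (i | j)
      · simpa [hX0] using integral_fun_fst (μ := P) (ν := P) fun ω ↦ X ω i
      · simpa [hY0] using integral_fun_snd (μ := P) (ν := P) fun ω ↦ Y ω j)
    (by
      rintro (i | j)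
      · exact (hfst.variance_fun_comp (hXi i).aemeasurable).symm
      · exact (hsnd.variance_fun_comp (hYj j).aemeasurable).symm)
    (by
      rintro (i | i) (j | j) -
      · exact (hfst.hasLaw.covariance_fun_comp (hXi i).aemeasurable (hXi j).aemeasurable).ge
      · exact (hcov i j).trans (hindep i j).ge
      · exact (covariance_comm _ _).trans_le <|
          (hcov j i).trans ((covariance_comm _ _).trans (hindep j i)).ge
      · exact (hsnd.hasLaw.covariance_fun_comp (hYj i).aemeasurable (hYj j).aemeasurable).ge)
    (Sum.elim u v)
  simp only [Sum.forall, Sum.elim_inl, Sum.elim_inr] at hslepian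
  exact hslepian.trans_eq
    (measureReal_prod_prod {ω | ∀ i, X ω i ≤ u i} {ω | ∀ j, Y ω j ≤ v j})

end NegativeDependence

local notation "γ" => gaussianReal 0 1
local notation "Φ" => cdf (gaussianReal 0 1)

section Equicorrelated

variable {ι : Type*} [Fintype ι] {ρ : ℝ}

/-- The law of a common factor together with independent noise, all of them standard normal. -/
abbrev factorNoiseLaw (ι : Type*) [Fintype ι] : Measure (ℝ × (ι → ℝ)) :=
  Measure.prod γ (Measure.pi fun _ ↦ γ)

/-- The vector with common factor `q.1` and noise `q.2`; under `factorNoiseLaw` its coordinates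
have variance `1` and all correlations equal to `ρ`, for `0 ≤ ρ ≤ 1`. -/
def equicorrelated (ρ : ℝ) (q : ℝ × (ι → ℝ)) (i : ι) : ℝ := √(1 - ρ) * q.2 i - √ρ * q.1

instance isGaussian_pi_gaussianReal : IsGaussian (Measure.pi fun _ : ι ↦ γ) := by
  have h := iIndepFun.hasGaussianLaw
    (fun i ↦ (measurePreserving_eval (fun _ : ι ↦ γ) i).hasLaw.hasGaussianLaw)
    (iIndepFun_pi fun _ ↦ aemeasurable_id)
  simpa using h.isGaussian_map

lemma hasGaussianLaw_equicorrelated :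
    HasGaussianLaw (equicorrelated (ι := ι) ρ) (factorNoiseLaw ι) := by
  let L : ℝ × (ι → ℝ) →L[ℝ] (ι → ℝ) := ContinuousLinearMap.pi fun i ↦
    √(1 - ρ) • (ContinuousLinearMap.proj i ∘L ContinuousLinearMap.snd ℝ ℝ (ι → ℝ)) -
      √ρ • ContinuousLinearMap.fst ℝ ℝ (ι → ℝ)
  exact IsGaussian.hasGaussianLaw_id.map L

lemma hasLaw_fst_factorNoiseLaw : HasLaw Prod.fst γ (factorNoiseLaw ι) :=
  measurePreserving_fst.hasLaw

lemma hasLaw_snd_apply_factorNoiseLaw (i : ι) :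
    HasLaw (fun q : ℝ × (ι → ℝ) ↦ q.2 i) γ (factorNoiseLaw ι) :=
  (measurePreserving_eval (fun _ : ι ↦ γ) i).hasLaw.fun_comp measurePreserving_snd.hasLaw

lemma integral_equicorrelated (i : ι) : ∫ q, equicorrelated ρ q i ∂(factorNoiseLaw ι) = 0 := by
  have hfst := hasLaw_fst_factorNoiseLaw (ι := ι)
  have hsnd := hasLaw_snd_apply_factorNoiseLaw i
  simp only [equicorrelated]
  rw [integral_sub (hsnd.hasGaussianLaw.integrable.const_mul _)
    (hfst.hasGaussianLaw.integrable.const_mul _), integral_const_mul, integral_const_mul,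
    hsnd.integral_eq, hfst.integral_eq, integral_id_gaussianReal, mul_zero, mul_zero, sub_zero]

lemma covariance_pi_gaussianReal [DecidableEq ι] (i j : ι) :
    cov[fun x ↦ x i, fun x ↦ x j; Measure.pi fun _ : ι ↦ γ] = if i = j then 1 else 0 := by
  have heval (k : ι) := (measurePreserving_eval (fun _ : ι ↦ γ) k).hasLaw
  split_ifs with hij
  · rw [hij, covariance_self (heval j).aemeasurable]
    exact (heval j).variance_eq.trans (by simp)
  · exact ((iIndepFun_pi (μ := fun _ : ι ↦ γ) fun _ ↦ aemeasurable_id).indepFun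
      hij).covariance_eq_zero (heval i).hasGaussianLaw.memLp_two (heval j).hasGaussianLaw.memLp_two

lemma covariance_equicorrelated [DecidableEq ι] (hρ0 : 0 ≤ ρ) (hρ1 : ρ ≤ 1) (i j : ι) :
    cov[fun q ↦ equicorrelated ρ q i, fun q ↦ equicorrelated ρ q j; factorNoiseLaw ι] =
      if i = j then 1 else ρ := by
  have hW := hasLaw_fst_factorNoiseLaw (ι := ι)
  have hξ := hasLaw_snd_apply_factorNoiseLaw (ι := ι)
  have hmemW := hW.hasGaussianLaw.memLp_two
  have hmemξ (k : ι) := (hξ k).hasGaussianLaw.memLp_two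
  have hWW : cov[Prod.fst, Prod.fst; factorNoiseLaw ι] = 1 := by
    rw [covariance_self hW.aemeasurable, hW.variance_eq]
    simp
  have hWξ (k : ι) : cov[Prod.fst, fun q : ℝ × (ι → ℝ) ↦ q.2 k; factorNoiseLaw ι] = 0 :=
    covariance_fst_snd_prod (X := id) (Y := fun x : ι → ℝ ↦ x k)
      IsGaussian.hasGaussianLaw_id.memLp_two
      (measurePreserving_eval (fun _ : ι ↦ γ) k).hasLaw.hasGaussianLaw.memLp_two
  have hξW (k : ι) : cov[fun q ↦ q.2 k, Prod.fst; factorNoiseLaw ι] = 0 :=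
    (covariance_comm _ _).trans (hWξ k)
  have hξξ : cov[fun q ↦ q.2 i, fun q ↦ q.2 j; factorNoiseLaw ι] = if i = j then 1 else 0 := by
    rw [← covariance_pi_gaussianReal]
    exact measurePreserving_snd.hasLaw.covariance_fun_comp (f := fun x : ι → ℝ ↦ x i)
      (g := fun x ↦ x j) (measurable_pi_apply i).aemeasurable (measurable_pi_apply j).aemeasurable
  simp only [equicorrelated]
  rw [covariance_fun_sub_fun_sub ((hmemξ i).const_mul _) (hmemW.const_mul _)
    ((hmemξ j).const_mul _) (hmemW.const_mul _)]
  simp only [covariance_const_mul_left, covariance_const_mul_right, hξξ, hWξ, hξW, hWW]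
  split_ifs <;> linarith [Real.mul_self_sqrt hρ0, Real.mul_self_sqrt (sub_nonneg.2 hρ1)]

lemma measureReal_forall_equicorrelated_le (hρ1 : ρ < 1) (u : ℝ) :
    (factorNoiseLaw ι).real {q | ∀ i, equicorrelated ρ q i ≤ u} =
      ∫ w, Φ ((u + √ρ * w) / √(1 - ρ)) ^ Fintype.card ι ∂γ := by
  have hρ : 0 < √(1 - ρ) := Real.sqrt_pos.2 (sub_pos.2 hρ1)
  have hset : MeasurableSet {q : ℝ × (ι → ℝ) | ∀ i, equicorrelated ρ q i ≤ u} := by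
    simp only [Set.ofPred_forall, equicorrelated]
    exact .iInter fun i ↦ measurableSet_le (by fun_prop) measurable_const
  have hslice (w : ℝ) : Prod.mk w ⁻¹' {q : ℝ × (ι → ℝ) | ∀ i, equicorrelated ρ q i ≤ u} =
      Set.univ.pi fun _ ↦ Set.Iic ((u + √ρ * w) / √(1 - ρ)) := by
    ext x
    simp [equicorrelated, le_div_iff₀' hρ, Pi.le_def]
  rw [measureReal_def, Measure.prod_apply hset, ← integral_toReal
    (measurable_measure_prodMk_left hset).aemeasurable (ae_of_all _ fun w ↦ measure_lt_top _ _)]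
  simp only [hslice, Measure.pi_pi, Finset.prod_const, Finset.card_univ, ENNReal.toReal_pow,
    cdf_eq_real, measureReal_def]

theorem measureReal_forall_le_le_integral_cdf_pow {Ω : Type*} [MeasurableSpace Ω] {P : Measure Ω}
    {X : Ω → ι → ℝ} (hX : HasGaussianLaw X P) (hX0 : ∀ i, ∫ ω, X ω i ∂P = 0)
    (hX1 : ∀ i, Var[fun ω ↦ X ω i; P] = 1) (hρ0 : 0 ≤ ρ) (hρ1 : ρ < 1)
    (hcov : ∀ i j, i ≠ j → cov[fun ω ↦ X ω i, fun ω ↦ X ω j; P] ≤ ρ) (u : ℝ) :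
    P.real {ω | ∀ i, X ω i ≤ u} ≤
      ∫ w, Φ ((u + √ρ * w) / √(1 - ρ)) ^ Fintype.card ι ∂γ := by
  classical
  rw [← measureReal_forall_equicorrelated_le hρ1]
  refine slepian_inequality hX hasGaussianLaw_equicorrelated hX0
    integral_equicorrelated (fun i ↦ ?_) (fun i j hij ↦ ?_) fun _ ↦ u
  · rw [hX1, ← covariance_self (hasGaussianLaw_equicorrelated.eval i).aemeasurable,
      covariance_equicorrelated hρ0 hρ1.le, if_pos rfl]
  · rw [covariance_equicorrelated hρ0 hρ1.le, if_neg hij]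
    exact hcov i j hij

end Equicorrelated

section NormalTail

lemma exists_mul_exp_neg_sq_div_le_one_sub_cdf :
    ∃ κ > 0, ∀ t : ℝ, 0 ≤ t → κ * Real.exp (-(t ^ 2 / 2)) / (1 + t) ≤ 1 - Φ t := by
  refine ⟨(√(2 * Real.pi))⁻¹ * Real.exp (-(3 / 2)), by positivity, fun t ht ↦ ?_⟩
  set q : ℝ := (√(2 * Real.pi))⁻¹ * Real.exp (-(3 / 2)) * Real.exp (-(t ^ 2 / 2))
  have ht1 : 0 < 1 + t := by linarith
  set h : ℝ := 1 / (1 + t) with hh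
  have hh0 : 0 < h := by positivity
  have hh1 : h ≤ 1 := (div_le_one ht1).2 (by linarith)
  have hth : t * h ≤ 1 := by
    rw [hh, mul_one_div, div_le_one ht1]
    linarith
  have hdensity : ∀ x ∈ Set.Ioc t (t + h), q ≤ gaussianPDFReal 0 1 x := fun x hx ↦ by
    simp only [q, gaussianPDFReal, mul_assoc, ← Real.exp_add, NNReal.coe_one, mul_one, sub_zero]
    gcongr
    nlinarith [hx.1, hx.2]
  calc q / (1 + t) = ∫ _ in Set.Ioc t (t + h), q := by
        rw [setIntegral_const, Real.volume_real_Ioc_of_le (by linarith), add_sub_cancel_left,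
          smul_eq_mul, hh, one_div_mul_eq_div]
    _ ≤ ∫ x in Set.Ioc t (t + h), gaussianPDFReal 0 1 x :=
        setIntegral_mono_on (integrableOn_const (by simp))
          (integrable_gaussianPDFReal 0 1).integrableOn measurableSet_Ioc hdensity
    _ = (γ).real (Set.Ioc t (t + h)) := by
        rw [measureReal_def, gaussianReal_apply_eq_integral 0 one_ne_zero, ENNReal.toReal_ofReal
          (integral_nonneg fun x ↦ gaussianPDFReal_nonneg 0 1 x)]
    _ ≤ (γ).real (Set.Iic t)ᶜ :=
        measureReal_mono fun x hx ↦ by simpa using hx.1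
    _ = 1 - Φ t := by rw [probReal_compl_eq_one_sub measurableSet_Iic, cdf_eq_real]

lemma cdf_zero_lt_one : Φ 0 < 1 := by
  obtain ⟨κ, hκ, htail⟩ := exists_mul_exp_neg_sq_div_le_one_sub_cdf
  have hpos : 0 < κ * Real.exp (-(0 ^ 2 / 2)) / (1 + 0) := by positivity
  linarith [htail 0 le_rfl]

lemma cdf_pow_le_exp (t : ℝ) (n : ℕ) : Φ t ^ n ≤ Real.exp (-(n * (1 - Φ t))) := by
  rw [← mul_neg, Real.exp_nat_mul]
  exact pow_le_pow_left₀ (cdf_nonneg _ t) (by linarith [Real.add_one_le_exp (-(1 - Φ t))]) n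

lemma integral_exp_neg_mul_abs_sub {w : ℝ} (hw : 0 < w) (m : ℝ) :
    ∫ x, Real.exp (-(w * |x - m|)) = 2 / w := by
  rw [integral_sub_right_eq_self (fun x ↦ Real.exp (-(w * |x|))) m,
    integral_comp_abs (f := fun x ↦ Real.exp (-(w * x)))]
  have h := integral_exp_mul_Ioi (neg_lt_zero.2 hw) 0
  simp only [neg_mul, mul_zero, Real.exp_zero] at h
  rw [h]
  field_simp

lemma gaussianPDFReal_mul_exp_le (w x : ℝ) :
    gaussianPDFReal 0 1 x * Real.exp (-(2 * w * max (w - x) 0)) ≤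
      Real.exp (-(w ^ 2 / 2)) * Real.exp (-(w * |x - w|)) := by
  have hdensity : gaussianPDFReal 0 1 x ≤ Real.exp (-(x ^ 2 / 2)) := by
    simp only [gaussianPDFReal, NNReal.coe_one, mul_one, sub_zero, neg_div]
    refine mul_le_of_le_one_left (Real.exp_pos _).le (inv_le_one_of_one_le₀ ?_)
    rw [Real.one_le_sqrt]
    linarith [Real.pi_gt_three]
  refine (mul_le_mul_of_nonneg_right hdensity (Real.exp_pos _).le).trans ?_
  rw [← Real.exp_add, ← Real.exp_add, Real.exp_le_exp]
  rcases le_total x w with hx | hx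
  · rw [max_eq_left (by linarith), abs_of_nonpos (by linarith)]
    nlinarith [sq_nonneg (x - w)]
  · rw [max_eq_right (by linarith), abs_of_nonneg (by linarith)]
    nlinarith [sq_nonneg (x - w)]

lemma integral_le_of_le_add_exp {f : ℝ → ℝ} {w A B : ℝ} (hw : 0 < w) (hB : 0 ≤ B)
    (hf : ∀ x, 0 ≤ f x) (hle : ∀ x, f x ≤ A + B * Real.exp (-(2 * w * max (w - x) 0))) :
    ∫ x, f x ∂γ ≤ A + B * (2 / w * Real.exp (-(w ^ 2 / 2))) := by
  have hI := integral_exp_neg_mul_abs_sub hw w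
  have hint : Integrable fun x ↦ Real.exp (-(w * |x - w|)) :=
    .of_integral_ne_zero (by rw [hI]; positivity)
  have hpt (x : ℝ) : gaussianPDFReal 0 1 x • f x ≤ A * gaussianPDFReal 0 1 x +
      B * Real.exp (-(w ^ 2 / 2)) * Real.exp (-(w * |x - w|)) :=
    calc gaussianPDFReal 0 1 x • f x
        ≤ gaussianPDFReal 0 1 x * (A + B * Real.exp (-(2 * w * max (w - x) 0))) :=
          mul_le_mul_of_nonneg_left (hle x) (gaussianPDFReal_nonneg 0 1 x)
      _ = A * gaussianPDFReal 0 1 x +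
          B * (gaussianPDFReal 0 1 x * Real.exp (-(2 * w * max (w - x) 0))) := by ring
      _ ≤ _ := by
          rw [mul_assoc B]
          gcongr _ + B * ?_
          exact gaussianPDFReal_mul_exp_le w x
  have hi₁ := (integrable_gaussianPDFReal 0 1).const_mul A
  have hi₂ := hint.const_mul (B * Real.exp (-(w ^ 2 / 2)))
  rw [integral_gaussianReal_eq_integral_smul one_ne_zero]
  refine (integral_mono_of_nonneg (ae_of_all _ fun x ↦
    mul_nonneg (gaussianPDFReal_nonneg 0 1 x) (hf x)) (hi₁.add hi₂) (ae_of_all _ hpt)).trans_eq ?_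
  rw [integral_add' hi₁ hi₂, integral_const_mul, integral_const_mul, hI,
    integral_gaussianPDFReal_eq_one 0 one_ne_zero]
  ring

end NormalTail

section ExtremeLevel

/-- Up to `O(1 / s)`, the centring constant for the maximum of `exp (s ^ 2 / 2)` independent
standard normal variables. -/
def extremeLevel (s : ℝ) : ℝ :=
  s - Real.log s / s

variable {s : ℝ}

lemma log_div_self_le_half (hs : 0 < s) : Real.log s / s ≤ s / 2 := by
  rw [div_le_iff₀ hs]
  nlinarith [Real.log_le_sub_one_of_pos hs, sq_nonneg (s - 1)]

lemma extremeLevel_le_self (hs : 1 ≤ s) : extremeLevel s ≤ s :=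
  sub_le_self _ (div_nonneg (Real.log_nonneg hs) (by linarith))

lemma self_mul_exp_extremeLevel_sq_le (hs : 1 ≤ s) :
    s * Real.exp (extremeLevel s ^ 2 / 2) ≤ Real.exp (s ^ 2 / 2 + 1 / 8) := by
  have hs0 : 0 < s := by linarith
  have hlog := Real.log_nonneg hs
  have hhalf : Real.log s / s ≤ 1 / 2 := by
    rw [div_le_iff₀ hs0]
    have h := Real.log_le_sub_one_of_pos (x := s / 2) (by positivity)
    rw [Real.log_div hs0.ne' two_ne_zero] at h
    linarith [Real.log_two_lt_d9]
  nth_rw 1 [← Real.exp_log hs0]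
  rw [← Real.exp_add, Real.exp_le_exp]
  have hsq : extremeLevel s ^ 2 = s ^ 2 - 2 * Real.log s + (Real.log s / s) ^ 2 := by
    rw [extremeLevel]
    field_simp
    ring
  nlinarith [div_nonneg hlog hs0.le]

lemma exists_mul_exp_le_exp_mul_one_sub_cdf :
    ∃ κ > 0, ∀ s t : ℝ, 1 ≤ s → 0 ≤ t → t ≤ extremeLevel s →
      κ * Real.exp (s * (extremeLevel s - t) / 4) ≤ Real.exp (s ^ 2 / 2) * (1 - Φ t) := by
  obtain ⟨κ, hκ, htail⟩ := exists_mul_exp_neg_sq_div_le_one_sub_cdf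
  refine ⟨κ * Real.exp (-(1 / 8)) / 2, by positivity, fun s t hs ht hts ↦ ?_⟩
  have hs0 : 0 < s := by linarith
  set b := extremeLevel s with hb
  have hbs : s / 2 ≤ b := by
    rw [hb, extremeLevel]
    linarith [log_div_self_le_half hs0]
  have hdist : s * (b - t) / 4 ≤ b ^ 2 / 2 - t ^ 2 / 2 := by
    nlinarith [mul_nonneg ht (sub_nonneg.2 hts)]
  refine le_trans ?_ (mul_le_mul_of_nonneg_left (htail t ht) (Real.exp_pos _).le)
  rw [mul_div_assoc', le_div_iff₀ (by linarith)]
  calc κ * Real.exp (-(1 / 8)) / 2 * Real.exp (s * (b - t) / 4) * (1 + t)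
      ≤ κ * Real.exp (-(1 / 8)) / 2 * Real.exp (b ^ 2 / 2 - t ^ 2 / 2) * (2 * s) := by
        gcongr
        linarith [extremeLevel_le_self hs]
    _ = κ * Real.exp (-(1 / 8)) * Real.exp (-(t ^ 2 / 2)) * (s * Real.exp (b ^ 2 / 2)) := by
        rw [sub_eq_add_neg, Real.exp_add]
        ring
    _ ≤ κ * Real.exp (-(1 / 8)) * Real.exp (-(t ^ 2 / 2)) * Real.exp (s ^ 2 / 2 + 1 / 8) := by
        gcongr
        exact self_mul_exp_extremeLevel_sq_le hs
    _ = Real.exp (s ^ 2 / 2) * (κ * Real.exp (-(t ^ 2 / 2))) := by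
        rw [Real.exp_add, Real.exp_neg (1 / 8)]
        field_simp

lemma exp_neg_le_factorial_div_pow {y : ℝ} (hy : 0 < y) (p : ℕ) :
    Real.exp (-y) ≤ p.factorial / y ^ p := by
  rw [Real.exp_neg, inv_le_comm₀ (Real.exp_pos _) (by positivity), inv_div]
  exact Real.pow_div_factorial_le_exp y hy.le p

/- Below the extreme level the expected number of exceedances grows exponentially in the distance,
so `Φ t ^ n` decays faster than any exponential. -/
lemma exists_cdf_pow_le_mul_exp (a : ℝ) :
    ∃ K : ℝ, ∀ (s t : ℝ) (n : ℕ), 1 ≤ s → n = Real.exp (s ^ 2 / 2) → 0 ≤ t →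
      Φ t ^ n ≤ K * Real.exp (-(a * s * max (extremeLevel s - t) 0)) := by
  obtain ⟨κ, hκ, hexceed⟩ := exists_mul_exp_le_exp_mul_one_sub_cdf
  obtain ⟨p, hp⟩ := exists_nat_ge (4 * a)
  refine ⟨max 1 (p.factorial / κ ^ p), fun s t n hs hn ht ↦ ?_⟩
  rcases le_total (extremeLevel s) t with hts | hts
  · rw [max_eq_right (sub_nonpos.2 hts), mul_zero, neg_zero, Real.exp_zero, mul_one]
    exact (pow_le_one₀ (cdf_nonneg _ t) (cdf_le_one _ t)).trans (le_max_left _ _)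
  rw [max_eq_left (sub_nonneg.2 hts)]
  set r := s * (extremeLevel s - t)
  have hr0 : 0 ≤ r := mul_nonneg (by linarith) (sub_nonneg.2 hts)
  calc Φ t ^ n ≤ Real.exp (-(κ * Real.exp (r / 4))) :=
        (cdf_pow_le_exp t n).trans <| Real.exp_le_exp.2 <| neg_le_neg <| by
          rw [hn]
          exact hexceed s t hs ht hts
    _ ≤ p.factorial / (κ * Real.exp (r / 4)) ^ p :=
        exp_neg_le_factorial_div_pow (by positivity) p
    _ = p.factorial / κ ^ p * Real.exp (-(p / 4 * r)) := by
        rw [mul_pow, ← Real.exp_nat_mul, Real.exp_neg]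
        field_simp
    _ ≤ max 1 (p.factorial / κ ^ p) * Real.exp (-(a * s * (extremeLevel s - t))) := by
        have hrate : a * r ≤ p / 4 * r := mul_le_mul_of_nonneg_right (by linarith) hr0
        rw [mul_assoc a]
        gcongr
        exact le_max_right _ _

end ExtremeLevel

section LowerTail

variable {δ c : ℝ}

lemma exists_cdf_pow_le_add (a : ℝ) :
    ∃ K > 0, ∀ (s t : ℝ) (n : ℕ), 1 ≤ s → n = Real.exp (s ^ 2 / 2) →
      Φ t ^ n ≤ Real.exp (-(n * (1 - Φ 0))) +
        K * Real.exp (-(a * s * max (extremeLevel s - t) 0)) := by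
  obtain ⟨K, hK⟩ := exists_cdf_pow_le_mul_exp a
  refine ⟨max K 1, by positivity, fun s t n hs hn ↦ ?_⟩
  rcases le_total t 0 with ht | ht
  · refine le_add_of_le_of_nonneg ?_ (by positivity)
    exact (pow_le_pow_left₀ (cdf_nonneg _ t) (monotone_cdf _ ht) n).trans (cdf_pow_le_exp 0 n)
  · refine le_add_of_nonneg_of_le (Real.exp_pos _).le ((hK s t n hs hn ht).trans ?_)
    gcongr
    exact le_max_left _ _

lemma exp_neg_extremeLevel_sub_sq_le (hc : 0 < c) {s : ℝ} (hs : 0 < s) :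
    Real.exp (-(((extremeLevel s - δ * s) / c) ^ 2 / 2)) ≤
      Real.exp (s ^ 2 / 2) ^ (-((1 - δ) ^ 2 / c ^ 2)) * s ^ ((1 - δ) / c ^ 2) := by
  rw [← Real.exp_mul, Real.rpow_def_of_pos hs, ← Real.exp_add, Real.exp_le_exp]
  have hsq : (1 - δ) ^ 2 * s ^ 2 - 2 * (1 - δ) * Real.log s ≤ (extremeLevel s - δ * s) ^ 2 := by
    have : (extremeLevel s - δ * s) ^ 2 =
        (1 - δ) ^ 2 * s ^ 2 - 2 * (1 - δ) * Real.log s + (Real.log s / s) ^ 2 := by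
      rw [extremeLevel]
      field_simp
      ring
    linarith [sq_nonneg (Real.log s / s)]
  calc -(((extremeLevel s - δ * s) / c) ^ 2 / 2)
      = -((extremeLevel s - δ * s) ^ 2 / (2 * c ^ 2)) := by ring
    _ ≤ -(((1 - δ) ^ 2 * s ^ 2 - 2 * (1 - δ) * Real.log s) / (2 * c ^ 2)) := by gcongr
    _ = _ := by
        field_simp
        ring

lemma exists_integral_cdf_pow_le (hc : 0 < c) (hδ : δ < 1) :
    ∃ K : ℝ, ∀ (s : ℝ) (n : ℕ), 1 ≤ s → Real.log s / s ≤ (1 - δ) * s / 2 →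
      n = Real.exp (s ^ 2 / 2) →
      ∫ w, Φ (δ * s + c * w) ^ n ∂γ ≤ Real.exp (-(n * (1 - Φ 0))) +
        K * (n ^ (-((1 - δ) ^ 2 / c ^ 2)) * s ^ ((1 - δ) / c ^ 2 - 1)) := by
  obtain ⟨K, hK, hcdf⟩ := exists_cdf_pow_le_add (2 * (1 - δ) / c ^ 2)
  have hδ' : 0 < 1 - δ := sub_pos.2 hδ
  refine ⟨K * (4 * c / (1 - δ)), fun s n hs hlog hn ↦ ?_⟩
  have hs0 : 0 < s := by linarith
  set w := (extremeLevel s - δ * s) / c with hw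
  have hcw : c * w = (1 - δ) * s - Real.log s / s := by
    rw [hw, extremeLevel]
    field_simp
    ring
  have hcw_lower : (1 - δ) * s / 2 ≤ c * w := by linarith
  have hcw_upper : c * w ≤ (1 - δ) * s := by
    linarith [div_nonneg (Real.log_nonneg hs) hs0.le]
  have hw0 : 0 < w := pos_of_mul_pos_right (lt_of_lt_of_le (by positivity) hcw_lower) hc.le
  have hpt (x : ℝ) : Φ (δ * s + c * x) ^ n ≤ Real.exp (-(n * (1 - Φ 0))) +
      K * Real.exp (-(2 * w * max (w - x) 0)) := by
    refine (hcdf s (δ * s + c * x) n hs hn).trans ?_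
    have hdist : extremeLevel s - (δ * s + c * x) = c * (w - x) := by
      rw [hw]
      field_simp
      ring
    have hrate : 2 * w ≤ 2 * (1 - δ) / c ^ 2 * s * c := by
      rw [← mul_le_mul_iff_of_pos_left hc]
      calc c * (2 * w) ≤ 2 * ((1 - δ) * s) := by linarith
        _ = _ := by field_simp
    rw [hdist, ← mul_zero c, ← mul_max_of_nonneg _ _ hc.le, mul_zero, ← mul_assoc]
    gcongr
  have hwinv : 2 / w ≤ 4 * c / (1 - δ) * s⁻¹ := by
    rw [← div_eq_mul_inv, div_div, div_le_div_iff₀ hw0 (by positivity)]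
    linarith
  refine (integral_le_of_le_add_exp hw0 hK.le (fun x ↦ pow_nonneg (cdf_nonneg _ _) n) hpt).trans ?_
  rw [mul_assoc K, hn, Real.rpow_sub hs0, Real.rpow_one]
  gcongr _ + K * ?_
  calc 2 / w * Real.exp (-(w ^ 2 / 2)) ≤ 4 * c / (1 - δ) * s⁻¹ *
        (Real.exp (s ^ 2 / 2) ^ (-((1 - δ) ^ 2 / c ^ 2)) * s ^ ((1 - δ) / c ^ 2)) := by
        gcongr
        exact exp_neg_extremeLevel_sub_sq_le hc hs0
    _ = _ := by ring

lemma isBigO_exp_neg_mul_rpow_mul_log_rpow {q : ℝ} (hq : 0 < q) (a b : ℝ) :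
    (fun x ↦ Real.exp (-(x * q))) =O[atTop] fun x ↦ x ^ a * Real.log x ^ b := by
  have hlog : (fun x : ℝ ↦ x⁻¹) =O[atTop] fun x ↦ Real.log x ^ b := by
    have h := isLittleO_log_rpow_rpow_atTop (-b) one_pos
    simp only [Real.rpow_one] at h
    refine (h.inv_rev ?_).isBigO.congr' .rfl ?_
    · filter_upwards [Real.tendsto_log_atTop.eventually_gt_atTop 0] with x hx h0
      exact absurd h0 (Real.rpow_pos_of_pos hx _).ne'
    · filter_upwards [Real.tendsto_log_atTop.eventually_gt_atTop 0] with x hx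
      rw [Real.rpow_neg hx.le, inv_inv]
  have hexp := (isLittleO_exp_neg_mul_rpow_atTop hq (a - 1)).isBigO
  refine (hexp.congr' (.of_eq (by ext x; ring_nf)) ?_).trans ((isBigO_refl _ _).mul hlog)
  filter_upwards [eventually_gt_atTop 0] with x hx
  rw [Real.rpow_sub_one hx.ne', div_eq_mul_inv]

theorem isBigO_integral_cdf_pow (hc : 0 < c) (hδ : δ < 1) :
    (fun n : ℕ ↦ ∫ w, Φ (δ * √(2 * Real.log n) + c * w) ^ n ∂γ) =O[atTop]
      fun n ↦ (n : ℝ) ^ (-((1 - δ) ^ 2 / c ^ 2)) *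
        Real.log n ^ (((1 - δ) / c ^ 2 - 1) / 2) := by
  obtain ⟨K, hK⟩ := exists_integral_cdf_pow_le hc hδ
  have hlog : Tendsto (fun n : ℕ ↦ Real.log n) atTop atTop :=
    Real.tendsto_log_atTop.comp tendsto_natCast_atTop_atTop
  have hs : Tendsto (fun n : ℕ ↦ √(2 * Real.log n)) atTop atTop :=
    Real.tendsto_sqrt_atTop.comp (hlog.const_mul_atTop two_pos)
  have hsmall : ∀ᶠ s : ℝ in atTop, Real.log s / s ≤ (1 - δ) * s / 2 := by
    filter_upwards [eventually_ge_atTop 2, Real.isLittleO_log_id_atTop.tendsto_div_nhds_zero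
      |>.eventually_le_const (sub_pos.2 hδ)] with s hs hlogs
    exact hlogs.trans (by nlinarith [sub_pos.2 hδ])
  have hexp := (isBigO_exp_neg_mul_rpow_mul_log_rpow (sub_pos.2 cdf_zero_lt_one)
    (-((1 - δ) ^ 2 / c ^ 2)) (((1 - δ) / c ^ 2 - 1) / 2)).comp_tendsto
      (tendsto_natCast_atTop_atTop (R := ℝ))
  refine .trans (.of_norm_eventuallyLE ?_) (hexp.add ((isBigO_refl _ _).const_mul_left
    (K * 2 ^ (((1 - δ) / c ^ 2 - 1) / 2))))
  filter_upwards [hlog.eventually_gt_atTop 0, hs.eventually_ge_atTop 1, hs.eventually hsmall]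
    with n hL hs1 hlogs
  have hsq : √(2 * Real.log n) ^ 2 / 2 = Real.log n := by
    rw [Real.sq_sqrt (by positivity)]
    ring
  have hn : (n : ℝ) = Real.exp (√(2 * Real.log n) ^ 2 / 2) := by
    rw [hsq, Real.exp_log]
    by_contra! h
    simp [le_antisymm h n.cast_nonneg] at hL
  have hpow : √(2 * Real.log n) ^ ((1 - δ) / c ^ 2 - 1) =
      2 ^ (((1 - δ) / c ^ 2 - 1) / 2) * Real.log n ^ (((1 - δ) / c ^ 2 - 1) / 2) := by
    rw [Real.sqrt_eq_rpow, ← Real.rpow_mul (by positivity), Real.mul_rpow two_pos.le hL.le,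
      one_div_mul_eq_div]
  rw [Real.norm_of_nonneg (integral_nonneg fun w ↦ pow_nonneg (cdf_nonneg _ _) n)]
  refine (hK _ n hs1 hlogs hn).trans_eq ?_
  rw [hpow, Function.comp_apply, Function.comp_apply]
  ring

end LowerTail

section StandardizedVectors

variable {Ω : Type*} [MeasurableSpace Ω] {P : Measure Ω} {n : ℕ} {X : Ω → Fin n → ℝ}
  {δ ρ C : ℝ}

lemma vecMax_le_iff (hn : 0 < n) (x : Fin n → ℝ) (u : ℝ) : vecMax x ≤ u ↔ ∀ i, x i ≤ u :=
  have : Nonempty (Fin n) := ⟨⟨0, hn⟩⟩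
  ciSup_le_iff (Set.finite_range x).bddAbove

lemma IsStdGaussianVector.corrMatrix_eq (hX : IsStdGaussianVector P X) (i j : Fin n) :
    corrMatrix P X i j = cov[fun ω ↦ X ω i, fun ω ↦ X ω j; P] := by
  simp [corrMatrix, hX.variance_eq_one]

theorem exists_isMaxBoundConstant (hδ : δ < 1) (hρ : ρ ∈ Set.Ioo (0 : ℝ) 1) :
    ∃ C : ℝ, 0 < C ∧ IsMaxBoundConstant δ ρ C := by
  have hρ0 := hρ.1
  have hρ1 : 0 < 1 - ρ := sub_pos.2 hρ.2
  have hc2 : (√ρ / √(1 - ρ)) ^ 2 = ρ / (1 - ρ) := by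
    rw [div_pow, Real.sq_sqrt hρ0.le, Real.sq_sqrt hρ1.le]
  have hα : (1 - δ) ^ 2 / (√ρ / √(1 - ρ)) ^ 2 = alphaZero δ ρ := by
    rw [hc2, alphaZero]
    field_simp
  have hβ : (1 - δ) / (√ρ / √(1 - ρ)) ^ 2 = betaZero δ ρ := by
    rw [hc2, betaZero]
    field_simp
  obtain ⟨C, hC, hbound⟩ := bound_of_isBigO_nat_atTop
    (isBigO_integral_cdf_pow (c := √ρ / √(1 - ρ)) (by positivity) hδ)
  refine ⟨C, hC, fun n hn Ω _ P X hX hR ↦ ?_⟩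
  simp only [hX.corrMatrix_eq] at hR
  simp only [vecMax_le_iff (zero_lt_two.trans_le hn)]
  refine (measureReal_forall_le_le_integral_cdf_pow hX.hasGaussianLaw hX.mean_eq_zero
    hX.variance_eq_one hρ0.le hρ.2 hR _).trans ?_
  have hlevel (w : ℝ) : (δ * √(2 * (1 - ρ) * Real.log n) + √ρ * w) / √(1 - ρ) =
      δ * √(2 * Real.log n) + √ρ / √(1 - ρ) * w := by
    rw [mul_right_comm, Real.sqrt_mul' _ hρ1.le]
    field_simp
  have hlog : 0 < Real.log n := Real.log_pos (by exact_mod_cast hn)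
  have hrate : 0 < (n : ℝ) ^ (-alphaZero δ ρ) * Real.log n ^ ((betaZero δ ρ - 1) / 2) :=
    mul_pos (Real.rpow_pos_of_pos (by positivity) _) (Real.rpow_pos_of_pos hlog _)
  simp only [hα, hβ] at hbound
  simp only [hlevel, Fintype.card_fin, mul_assoc C]
  refine ((Real.le_norm_self _).trans (hbound hrate.ne')).trans_eq ?_
  rw [Real.norm_of_nonneg hrate.le]

theorem IsMaxBoundConstant.measureReal_forall_le (hC : IsMaxBoundConstant δ ρ C) {ι : Type*}
    [Fintype ι] (hι : 2 ≤ Fintype.card ι) {X : Ω → ι → ℝ} (hX : HasGaussianLaw X P)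
    (hX0 : ∀ i, ∫ ω, X ω i ∂P = 0) (hX1 : ∀ i, Var[fun ω ↦ X ω i; P] = 1)
    (hcov : ∀ i j, i ≠ j → cov[fun ω ↦ X ω i, fun ω ↦ X ω j; P] ≤ ρ) :
    P.real {ω | ∀ i, X ω i ≤ δ * √(2 * (1 - ρ) * Real.log (Fintype.card ι))} ≤
      C * (Fintype.card ι : ℝ) ^ (-alphaZero δ ρ) *
        Real.log (Fintype.card ι) ^ ((betaZero δ ρ - 1) / 2) := by
  let e := Fintype.equivFin ι
  let Y (ω : Ω) (k : Fin (Fintype.card ι)) : ℝ := X ω (e.symm k)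
  have hYG : HasGaussianLaw Y P := hX.map_fun
    (ContinuousLinearMap.pi fun k ↦ ContinuousLinearMap.proj (e.symm k) : (ι → ℝ) →L[ℝ] _)
  have := hYG.isGaussian_map
  have hmeas (k : Fin (Fintype.card ι)) : Measurable fun y : Fin (Fintype.card ι) → ℝ ↦ y k :=
    measurable_pi_apply k
  have hstd : IsStdGaussianVector (P.map Y) fun y ↦ y :=
    { hasGaussianLaw := IsGaussian.hasGaussianLaw_id
      mean_eq_zero := fun k ↦
        (integral_map hYG.aemeasurable (hmeas k).aestronglyMeasurable).trans (hX0 (e.symm k))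
      variance_eq_one := fun k ↦
        (variance_map (hmeas k).aemeasurable hYG.aemeasurable).trans (hX1 (e.symm k)) }
  have hbound := hC _ hι _ (P.map Y) (fun y ↦ y) hstd fun k l hkl ↦ by
    rw [hstd.corrMatrix_eq, covariance_map (hmeas k).aestronglyMeasurable
      (hmeas l).aestronglyMeasurable hYG.aemeasurable]
    exact hcov _ _ (e.symm.injective.ne hkl)
  simp only [vecMax_le_iff (zero_lt_two.trans_le hι)] at hbound
  rw [map_measureReal_apply_of_aemeasurable hYG.aemeasurable] at hbound
  · simpa only [Set.preimage_ofPred_eq, Y, e.symm.forall_congr_left, e.symm.symm_apply_apply,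
      e.symm_symm, e.symm_apply_apply] using hbound
  · simp only [Set.ofPred_forall]
    exact .iInter fun k ↦ measurableSet_le (by fun_prop) measurable_const

lemma hasGaussianLaw_prodMk_neg {ι : Type*} [Finite ι] {X : Ω → ι → ℝ}
    (hX : HasGaussianLaw X P) : HasGaussianLaw (fun ω ↦ (X ω, -X ω)) P :=
  have := Fintype.ofFinite ι
  hX.map_fun ((ContinuousLinearMap.id ℝ (ι → ℝ)).prod (-ContinuousLinearMap.id ℝ _))

lemma forall_le_and_forall_neg_le_of_norm_le {ι : Type*} [Fintype ι] {x : ι → ℝ} {u : ℝ}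
    (hx : ‖x‖ ≤ u) : (∀ i, x i ≤ u) ∧ ∀ i, (-x) i ≤ u :=
  forall_and.1 fun i ↦ abs_le'.1 ((norm_le_pi_norm x i).trans hx)

theorem IsMaxBoundConstant.measureReal_norm_le (hC : IsMaxBoundConstant δ ρ C) (hρ : -1 ≤ ρ)
    (hn : 1 ≤ n) (hX : IsStdGaussianVector P X) (hR : ∀ i j, i ≠ j → |corrMatrix P X i j| ≤ ρ) :
    P.real {ω | ‖X ω‖ ≤ δ * √(2 * (1 - ρ) * Real.log (2 * n))} ≤
      C * (2 * n : ℝ) ^ (-alphaZero δ ρ) * Real.log (2 * n) ^ ((betaZero δ ρ - 1) / 2) := by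
  have := hX.hasGaussianLaw.isProbabilityMeasure
  simp only [hX.corrMatrix_eq, abs_le'] at hR
  have hself (i : Fin n) : cov[fun ω ↦ X ω i, fun ω ↦ X ω i; P] = 1 :=
    (covariance_self (hX.hasGaussianLaw.eval i).aemeasurable).trans (hX.variance_eq_one i)
  have hneg (i j : Fin n) : -cov[fun ω ↦ X ω i, fun ω ↦ X ω j; P] ≤ ρ := by
    obtain rfl | hij := eq_or_ne i j
    · rwa [hself]
    · exact (hR i j hij).2
  have hcard : (Fintype.card (Fin n ⊕ Fin n) : ℝ) = 2 * n := by
    simp [two_mul]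
  have hbound := hC.measureReal_forall_le (ι := Fin n ⊕ Fin n) (by simp; omega)
    (hasGaussianLaw_sumElim (hasGaussianLaw_prodMk_neg hX.hasGaussianLaw))
    (by simp [hX.mean_eq_zero, integral_neg])
    (by simp [hX.variance_eq_one, variance_fun_neg])
    (by
      rintro (i | i) (j | j) hij <;>
        simp only [Sum.elim_inl, Sum.elim_inr, Pi.neg_apply, covariance_fun_neg_left,
          covariance_fun_neg_right, neg_neg]
      · exact (hR i j fun h ↦ hij (h ▸ rfl)).1
      · exact hneg i j
      · exact hneg i j
      · exact (hR i j fun h ↦ hij (h ▸ rfl)).1)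
  rw [hcard] at hbound
  refine (measureReal_mono fun ω hω ↦ ?_).trans hbound
  exact Sum.forall.2 (forall_le_and_forall_neg_le_of_norm_le hω)

lemma mul_rpow_mul_log_rpow_sq (C a b : ℝ) (n : ℕ) :
    (C * (n : ℝ) ^ a * Real.log n ^ (b / 2)) ^ 2 = C ^ 2 * (n : ℝ) ^ (2 * a) * Real.log n ^ b := by
  have hlog : (Real.log n ^ (b / 2)) ^ 2 = Real.log n ^ b := by
    rw [← Real.rpow_mul_natCast (Real.log_natCast_nonneg n), Nat.cast_two,
      div_mul_cancel₀ b two_ne_zero]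
  have hpow : ((n : ℝ) ^ a) ^ 2 = (n : ℝ) ^ (2 * a) := by
    rw [← Real.rpow_mul_natCast n.cast_nonneg, Nat.cast_two, mul_comm]
  rw [mul_pow, mul_pow, hlog, hpow]

lemma IsStdGaussianVector.neg (hX : IsStdGaussianVector P X) :
    IsStdGaussianVector P fun ω ↦ -X ω where
  hasGaussianLaw := hX.hasGaussianLaw.fun_neg
  mean_eq_zero i := by simp [integral_neg, hX.mean_eq_zero]
  variance_eq_one i := by
    have := hX.hasGaussianLaw.isProbabilityMeasure
    simp [variance_fun_neg, hX.variance_eq_one]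

lemma IsStdGaussianVector.measureReal_norm_le_le_mul (hX : IsStdGaussianVector P X)
    (hcov : ∀ i j, i ≠ j → 0 ≤ cov[fun ω ↦ X ω i, fun ω ↦ X ω j; P]) (u : ℝ) :
    P.real {ω | ‖X ω‖ ≤ u} ≤ P.real {ω | ∀ i, X ω i ≤ u} * P.real {ω | ∀ i, (-X ω) i ≤ u} := by
  have hG := hX.hasGaussianLaw
  have := hG.isProbabilityMeasure
  refine (measureReal_mono fun ω ↦ forall_le_and_forall_neg_le_of_norm_le).trans
    (measureReal_forall_le_and_forall_le_le_mul (hasGaussianLaw_prodMk_neg hG)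
      hX.mean_eq_zero hX.neg.mean_eq_zero (fun i j ↦ ?_) _ _)
  simp only [Pi.neg_apply, covariance_fun_neg_right, Left.neg_nonpos_iff]
  obtain rfl | hij := eq_or_ne i j
  · rw [covariance_self (hG.eval i).aemeasurable]
    exact variance_nonneg _ _
  · exact hcov i j hij

theorem IsMaxBoundConstant.measureReal_norm_le_sq (hC : IsMaxBoundConstant δ ρ C) (hn : 2 ≤ n)
    (hX : IsStdGaussianVector P X) (hR : ∀ i j, i ≠ j → corrMatrix P X i j ∈ Set.Icc 0 ρ) :
    P.real {ω | ‖X ω‖ ≤ δ * √(2 * (1 - ρ) * Real.log n)} ≤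
      C ^ 2 * (n : ℝ) ^ (-2 * alphaZero δ ρ) * Real.log n ^ (betaZero δ ρ - 1) := by
  have := hX.hasGaussianLaw.isProbabilityMeasure
  simp only [hX.corrMatrix_eq] at hR
  have hcard : 2 ≤ Fintype.card (Fin n) := by simpa using hn
  have hle := hC.measureReal_forall_le hcard hX.hasGaussianLaw hX.mean_eq_zero
    hX.variance_eq_one fun i j hij ↦ (hR i j hij).2
  have hle_neg := hC.measureReal_forall_le hcard hX.neg.hasGaussianLaw hX.neg.mean_eq_zero
    hX.neg.variance_eq_one fun i j hij ↦ by
      simpa only [Pi.neg_apply, covariance_fun_neg_left, covariance_fun_neg_right, neg_neg]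
        using (hR i j hij).2
  rw [Fintype.card_fin] at hle hle_neg
  rw [neg_mul, ← mul_neg, ← mul_rpow_mul_log_rpow_sq, sq]
  exact (hX.measureReal_norm_le_le_mul (fun i j hij ↦ (hR i j hij).1) _).trans
    (mul_le_mul hle hle_neg measureReal_nonneg (measureReal_nonneg.trans hle))

end StandardizedVectors

theorem corollary3p2_general (δ₀ ρ₀ : ℝ) (hδ₀ : δ₀ < 1) (hρ₀ : ρ₀ ∈ Set.Ioo (0 : ℝ) 1) :
    (∃ C : ℝ, 0 < C ∧ IsMaxBoundConstant δ₀ ρ₀ C) ∧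
    ∀ C : ℝ, IsMaxBoundConstant δ₀ ρ₀ C →
      ∀ (n : ℕ) (Ω : Type*) [MeasurableSpace Ω] (P : Measure Ω) (X : Ω → Fin n → ℝ),
        IsStdGaussianVector P X →
        (1 ≤ n → (∀ i j, i ≠ j → |corrMatrix P X i j| ≤ ρ₀) →
          P.real {ω | ‖X ω‖ ≤ δ₀ * √(2 * (1 - ρ₀) * Real.log (2 * n))} ≤
            C * (2 * n : ℝ) ^ (-alphaZero δ₀ ρ₀) *
              Real.log (2 * n) ^ ((betaZero δ₀ ρ₀ - 1) / 2)) ∧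
        (2 ≤ n → (∀ i j, i ≠ j → corrMatrix P X i j ∈ Set.Icc 0 ρ₀) →
          P.real {ω | ‖X ω‖ ≤ δ₀ * √(2 * (1 - ρ₀) * Real.log n)} ≤
            C ^ 2 * (n : ℝ) ^ (-2 * alphaZero δ₀ ρ₀) *
              Real.log n ^ (betaZero δ₀ ρ₀ - 1)) :=
  ⟨exists_isMaxBoundConstant hδ₀ hρ₀, fun _ hC _ _ _ _ _ hX ↦
    ⟨fun hn hR ↦ hC.measureReal_norm_le (by linarith [hρ₀.1]) hn hX hR,
      fun hn hR ↦ hC.measureReal_norm_le_sq hn hX hR⟩⟩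

end

/-- The norm on `Fin n → ℝ` is the sup norm `‖·‖_∞`. -/
theorem corollary3p2 (δ₀ ρ₀ : ℝ) (hδ₀ : δ₀ ∈ Set.Ioo (0 : ℝ) 1) (hρ₀ : ρ₀ ∈ Set.Ioo (0 : ℝ) 1) :
    (∃ C : ℝ, 0 < C ∧ IsMaxBoundConstant δ₀ ρ₀ C) ∧
    ∀ C : ℝ, 0 < C → IsMaxBoundConstant δ₀ ρ₀ C →
      ∀ (n : ℕ) (Ω : Type*) [MeasurableSpace Ω] (P : Measure Ω) (X : Ω → Fin n → ℝ),
        IsStdGaussianVector P X →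
        (1 ≤ n → (∀ i j, i ≠ j → |corrMatrix P X i j| ≤ ρ₀) →
          P.real {ω | ‖X ω‖ ≤ δ₀ * √(2 * (1 - ρ₀) * Real.log (2 * n))} ≤
            C * (2 * n : ℝ) ^ (-alphaZero δ₀ ρ₀) *
              Real.log (2 * n) ^ ((betaZero δ₀ ρ₀ - 1) / 2)) ∧
        (2 ≤ n → (∀ i j, i ≠ j → corrMatrix P X i j ∈ Set.Icc 0 ρ₀) →
          P.real {ω | ‖X ω‖ ≤ δ₀ * √(2 * (1 - ρ₀) * Real.log n)} ≤
            C ^ 2 * (n : ℝ) ^ (-2 * alphaZero δ₀ ρ₀) *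
              Real.log n ^ (betaZero δ₀ ρ₀ - 1)) := by
  obtain ⟨hexists, hbound⟩ := corollary3p2_general δ₀ ρ₀ hδ₀.2 hρ₀
  exact ⟨hexists, fun C _ ↦ hbound C⟩
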